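/- Let $k$ be an algebraically closed field of characteristic zero and let $n\ge 1$ be an integer. Equip the polynomial algebra $k[x_0,x_1,\dots,x_n]$ with the $\mathbb{Z}^n$-grading whose piece of degree $m=(m_1,\dots,m_n)$ is $k[x_0]\,x_1^{m_1}\cdots x_n^{m_n}$ if $m\in\mathbb{N}^n$, and $0$ otherwise. Let $I$ be an ideal of $k[x_0,\dots,x_n]$ that is homogeneous for this grading (i.e. generated by homogeneous elements). Then the following are equivalent: (i) $I$ is normal, i.e. $I^e$ is integrally closed for every integer $e\ge 1$; (ii) $I^e$ is integrally closed for every $e\in\{1,\dots,n\}$. Here an ideal $J$ of a commutative ring $A$ is called integrally closed if it contains every $a\in A$ satisfying an equation $a^r+c_1a^{r-1}+\dots+c_r=0$ with $r\ge 1$ and $c_i\in J^i$ for $i=1,\dots,r$. -/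

import Mathlib

/-- The element `a` is integral over the ideal `I`: it satisfies an equation
`a ^ r + c₁ a ^ (r - 1) + ⋯ + c_r = 0` with `r ≥ 1` and `c_i ∈ I ^ i` for `1 ≤ i ≤ r`. -/
def IsIntegralOverIdeal {A : Type*} [CommRing A] (I : Ideal A) (a : A) : Prop :=
  ∃ r : ℕ, 1 ≤ r ∧ ∃ c : ℕ → A, (∀ i ∈ Finset.Icc 1 r, c i ∈ I ^ i) ∧
    a ^ r + ∑ i ∈ Finset.Icc 1 r, c i * a ^ (r - i) = 0

/-- The ideal `I` is integrally closed: every element integral over `I` belongs to `I`. -/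
def IsIntegrallyClosedIdeal {A : Type*} [CommRing A] (I : Ideal A) : Prop :=
  ∀ a : A, IsIntegralOverIdeal I a → a ∈ I

/-- The ideal `I` is normal: all its powers `I ^ e`, `e ≥ 1`, are integrally closed. -/
def IsNormalIdeal {A : Type*} [CommRing A] (I : Ideal A) : Prop :=
  ∀ e : ℕ, 1 ≤ e → IsIntegrallyClosedIdeal (I ^ e)

/-- The degrees of the variables `x₀, x₁, …, x_n` in `ℤⁿ`: `x₀` has degree `0`, and `x_i` has
degree the `i`-th standard basis vector. -/
def varDegree (n : ℕ) : Fin (n + 1) → (Fin n → ℤ) :=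
  Fin.cons 0 fun i => Pi.single i 1

/-- The piece of degree `m ∈ ℤⁿ` of the polynomial algebra `k[x₀, …, x_n]`. It is
`k[x₀] x₁ ^ m₁ ⋯ x_n ^ m_n` if `m ∈ ℕⁿ` (see `mem_gradedPiece_natCast`), and zero otherwise
(see `gradedPiece_eq_bot`). -/
noncomputable def gradedPiece (k : Type*) [Field k] (n : ℕ) (m : Fin n → ℤ) :
    Submodule k (MvPolynomial (Fin (n + 1)) k) :=
  MvPolynomial.weightedHomogeneousSubmodule k (varDegree n) m

/-- The `ℤⁿ`-grading of `k[x₀, …, x_n]`. -/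
noncomputable instance gradedPiece.gradedAlgebra (k : Type*) [Field k] (n : ℕ) :
    GradedAlgebra (gradedPiece k n) :=
  MvPolynomial.weightedGradedAlgebra k (varDegree n)

theorem weight_varDegree (n : ℕ) (d : Fin (n + 1) →₀ ℕ) :
    Finsupp.weight (varDegree n) d = fun i => (d i.succ : ℤ) := by
  funext j
  simp [Finsupp.weight_apply, Finsupp.sum_fintype, Fin.sum_univ_succ, varDegree, Finset.sum_apply,
    Pi.single_apply]

/-- The piece of degree `m ∈ ℕⁿ` is `k[x₀] x₁ ^ m₁ ⋯ x_n ^ m_n`. -/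
theorem mem_gradedPiece_natCast {k : Type*} [Field k] {n : ℕ} (m : Fin n → ℕ)
    (f : MvPolynomial (Fin (n + 1)) k) :
    f ∈ gradedPiece k n (fun i => (m i : ℤ)) ↔
      ∃ p : Polynomial k, f = Polynomial.aeval (MvPolynomial.X 0) p *
        ∏ i : Fin n, MvPolynomial.X i.succ ^ m i := by
  have hmon : ∀ a : ℕ, ∀ b : k, MvPolynomial.monomial (Finsupp.equivFunOnFinite.symm
      (Fin.cons a m : Fin (n + 1) → ℕ)) b = Polynomial.aeval (MvPolynomial.X 0)
        (Polynomial.monomial a b) * ∏ i : Fin n, MvPolynomial.X i.succ ^ m i := by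
    intro a b
    rw [MvPolynomial.monomial_eq, Finsupp.prod_fintype _ _ (by simp), Fin.prod_univ_succ,
      Polynomial.aeval_monomial]
    simp [MvPolynomial.algebraMap_eq, mul_assoc]
  constructor
  · intro hf
    refine ⟨∑ d ∈ f.support, Polynomial.monomial (d 0) (f.coeff d), ?_⟩
    rw [map_sum, Finset.sum_mul]
    conv_lhs => rw [f.as_sum]
    refine Finset.sum_congr rfl fun d hd => ?_
    have h := hf (MvPolynomial.mem_support_iff.mp hd)
    rw [weight_varDegree] at h
    have hd' : d = Finsupp.equivFunOnFinite.symm (Fin.cons (d 0) m : Fin (n + 1) → ℕ) := by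
      ext i
      refine Fin.cases ?_ (fun j => ?_) i
      · simp
      · have := congrFun h j
        simpa using this
    rw [← hmon, ← hd']
  · rintro ⟨p, rfl⟩
    induction p using Polynomial.induction_on' with
    | add p q hp hq => rw [map_add, add_mul]; exact add_mem hp hq
    | monomial a b =>
      rw [← hmon]
      refine MvPolynomial.isWeightedHomogeneous_monomial _ _ _ ?_
      rw [weight_varDegree]
      simp

/-- The pieces of degree `m ∉ ℕⁿ` are zero. -/
theorem gradedPiece_eq_bot {k : Type*} [Field k] {n : ℕ} (m : Fin n → ℤ) {i : Fin n}
    (hi : m i < 0) : gradedPiece k n m = ⊥ := by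
  rw [eq_bot_iff]
  intro f hf
  rw [Submodule.mem_bot, MvPolynomial.eq_zero_iff]
  intro d
  by_contra hd
  have h := hf hd
  rw [weight_varDegree] at h
  have := congrFun h i
  omega

/-!
Write `k[x₀, …, x_n] = R[x₁, …, x_n]` with `R = k[x₀]`, a Dedekind domain. At a prime `P` of `R`, a
multigraded ideal `J` is described by the exponents `(i, m)` such that `P ^ i * xᵐ` lies in `J`
locally, and the exponents of `J ^ e` are the `e`-fold sums of those of `J`. The powers of `J` are
integrally closed exactly when these sets are saturated, that is, consist of all the lattice points
of the `e`-th dilation of the Newton polyhedron of `J`.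

A lattice point `w` of the dilation by `e + 1` dominates a combination of generators with
nonnegative weights of sum `e + 1`. The polyhedron being stable under increasing `i`, Carathéodory's
theorem in the `n` coordinates of `m` gives such a combination with at most `n + 1` weights. If
`n ≤ e`, one of them is at least `1`: its generator splits off, and `w` is the sum of this generator
and a lattice point of the dilation by `e`. Hence saturation of the first `n` steps implies
saturation of all of them.

If `f` is integral over `J ^ e`, then `c * f ^ s ∈ J ^ (e * s)` for some `c ≠ 0` and all `s`. By
Dickson's lemma, the exponents of the leading term of `f` belong to the saturation, so the leading
term of `f` is in `J ^ e` once the latter is saturated at every `P`, and it can be subtracted.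
-/

section LinearProgramming

variable {ι 𝕜 V : Type*} [Field 𝕜] [LinearOrder 𝕜] [IsStrictOrderedRing 𝕜] [AddCommGroup V]
  [Module 𝕜 V]

open Finsupp

theorem exists_nonneg_sub_smul_support_ssubset {l μ : ι →₀ 𝕜} (hl : 0 ≤ l)
    (hμl : μ.support ⊆ l.support) (hμ : ∃ i, 0 < μ i) :
    ∃ τ : 𝕜, 0 ≤ τ ∧ 0 ≤ l - τ • μ ∧ (l - τ • μ).support ⊂ l.support := by
  classical
  obtain ⟨i₀, hi₀⟩ := hμ
  have hpos : (l.support.filter (0 < μ ·)).Nonempty :=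
    ⟨i₀, Finset.mem_filter.2 ⟨hμl (mem_support_iff.2 hi₀.ne'), hi₀⟩⟩
  obtain ⟨i, hi, hmin⟩ := Finset.exists_min_image _ (fun i => l i / μ i) hpos
  obtain ⟨hil, hμi⟩ := Finset.mem_filter.1 hi
  have hτ : 0 ≤ l i / μ i := div_nonneg (hl i) hμi.le
  refine ⟨l i / μ i, hτ, fun j => ?_, Finset.ssubset_iff_of_subset ?_ |>.2 ⟨i, hil, ?_⟩⟩
  · rw [coe_zero, Pi.zero_apply, Finsupp.sub_apply, Finsupp.smul_apply, smul_eq_mul, sub_nonneg]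
    rcases le_or_gt (μ j) 0 with hj | hj
    · exact (mul_nonpos_of_nonneg_of_nonpos hτ hj).trans (hl j)
    · exact (le_div_iff₀ hj).1
        (hmin j (Finset.mem_filter.2 ⟨hμl (mem_support_iff.2 hj.ne'), hj⟩))
  · exact support_sub.trans (Finset.union_subset subset_rfl (support_smul.trans hμl))
  · simp [div_mul_cancel₀ _ hμi.ne']

theorem exists_relation_of_not_linearIndepOn {x : ι → V} {h : ι → 𝕜} (hh : 0 ≤ h) {s : Finset ι}
    (hdep : ¬ LinearIndepOn 𝕜 x (s : Set ι)) :
    ∃ μ : ι →₀ 𝕜, μ.support ⊆ s ∧ linearCombination 𝕜 x μ = 0 ∧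
      0 ≤ linearCombination 𝕜 h μ ∧ ∃ i, 0 < μ i := by
  obtain ⟨μ, hμs, hμx, hμ0⟩ := linearDepOn_iff'.1 hdep
  rw [mem_supported, Finset.coe_subset] at hμs
  wlog hcost : 0 ≤ linearCombination 𝕜 h μ generalizing μ
  · refine this (-μ) (by rwa [support_neg]) (by rw [map_neg, hμx, neg_zero]) (neg_ne_zero.2 hμ0) ?_
    rw [map_neg]
    exact neg_nonneg.2 (le_of_not_ge hcost)
  by_cases hpos : ∃ i, 0 < μ i
  · exact ⟨μ, hμs, hμx, hcost, hpos⟩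
  · push Not at hpos
    obtain ⟨i, hi⟩ := DFunLike.ne_iff.1 hμ0
    refine ⟨-μ, by rwa [support_neg], by rw [map_neg, hμx, neg_zero],
      Finset.sum_nonneg fun j _ => ?_, i, neg_pos.2 ((hpos i).lt_of_ne hi)⟩
    exact mul_nonneg (neg_nonneg.2 (hpos j)) (hh j)

theorem exists_linearIndepOn_support {x : ι → V} {h : ι → 𝕜} (hh : 0 ≤ h) {l : ι →₀ 𝕜}
    (hl : 0 ≤ l) :
    ∃ l' : ι →₀ 𝕜, 0 ≤ l' ∧ LinearIndepOn 𝕜 x (l'.support : Set ι) ∧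
      linearCombination 𝕜 x l' = linearCombination 𝕜 x l ∧
      linearCombination 𝕜 h l' ≤ linearCombination 𝕜 h l := by
  induction hs : l.support using Finset.strongInduction generalizing l with | H s ih
  subst hs
  by_cases hindep : LinearIndepOn 𝕜 x (l.support : Set ι)
  · exact ⟨l, hl, hindep, rfl, le_rfl⟩
  · obtain ⟨μ, hμl, hμx, hμh, hμ⟩ := exists_relation_of_not_linearIndepOn hh hindep
    obtain ⟨τ, hτ, hnonneg, hlt⟩ := exists_nonneg_sub_smul_support_ssubset hl hμl hμ
    obtain ⟨l', hl', hindep', hx', hh'⟩ := ih _ hlt hnonneg rfl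
    refine ⟨l', hl', hindep', hx'.trans ?_, hh'.trans ?_⟩
    · rw [map_sub, map_smul, hμx, smul_zero, sub_zero]
    · rw [map_sub, map_smul]
      exact sub_le_self _ (smul_nonneg hτ hμh)

/- Carathéodory's theorem for the points `(y i).2`, choosing among all possible weights some that
minimise the first coordinate; this saves one point compared with the theorem in `𝕜 × V`. -/
theorem exists_card_support_le_finrank_succ [PartialOrder V] [Module.Finite 𝕜 V] {y : ι → 𝕜 × V}
    (hy : ∀ i, 0 ≤ (y i).1) {l : ι →₀ 𝕜} (hl : 0 ≤ l) :
    ∃ l' : ι →₀ 𝕜, 0 ≤ l' ∧ l'.support.card ≤ Module.finrank 𝕜 V + 1 ∧ l'.degree = l.degree ∧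
      linearCombination 𝕜 y l' ≤ linearCombination 𝕜 y l := by
  have hlift (μ : ι →₀ 𝕜) : linearCombination 𝕜 (fun i => ((1 : 𝕜), (y i).2)) μ =
      (μ.degree, (linearCombination 𝕜 y μ).2) := by
    ext <;> simp [linearCombination_apply, Finsupp.sum, degree_apply, Prod.fst_sum, Prod.snd_sum]
  have hheight (μ : ι →₀ 𝕜) : linearCombination 𝕜 (fun i => (y i).1) μ =
      (linearCombination 𝕜 y μ).1 := by
    simp [linearCombination_apply, Finsupp.sum, Prod.fst_sum]
  obtain ⟨l', hl', hindep, hx, hh⟩ := exists_linearIndepOn_support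
    (x := fun i => ((1 : 𝕜), (y i).2)) (h := fun i => (y i).1) hy hl
  rw [hlift, hlift, Prod.mk.injEq] at hx
  rw [hheight, hheight] at hh
  refine ⟨l', hl', ?_, hx.1, hh, hx.2.le⟩
  have hcard := LinearIndependent.fintype_card_le_finrank hindep
  simpa [add_comm] using hcard

end LinearProgramming

theorem exists_nsmul_eq_mapRange_natCast {ι : Type*} {l : ι →₀ ℚ} (hl : 0 ≤ l) :
    ∃ q : ℕ, 0 < q ∧ ∃ c : ι →₀ ℕ, q • l = c.mapRange (Nat.cast : ℕ → ℚ) Nat.cast_zero := by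
  refine ⟨∏ i ∈ l.support, (l i).den, Finset.prod_pos fun i _ => (l i).den_pos,
    l.mapRange (fun a => (∏ i ∈ l.support, (l i).den) / a.den * a.num.toNat) (by simp), ?_⟩
  ext i
  by_cases hi : i ∈ l.support
  · obtain ⟨k, hk⟩ := Finset.dvd_prod_of_mem (fun i => (l i).den) hi
    have hnum : ((l i).num.toNat : ℚ) = (l i).den * l i := by
      rw [Rat.den_mul_eq_num]
      exact_mod_cast Int.toNat_of_nonneg (Rat.num_nonneg.2 (hl i))
    rw [Finsupp.smul_apply, nsmul_eq_mul, Finsupp.mapRange_apply, Finsupp.mapRange_apply, hk,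
      Nat.mul_div_cancel_left _ (l i).den_pos, Nat.cast_mul, Nat.cast_mul, hnum]
    ring
  · simp [Finsupp.notMem_support_iff.1 hi]

theorem linearCombination_nonneg {ι 𝕜 V : Type*} [Ring 𝕜] [PartialOrder 𝕜] [AddCommGroup V]
    [Module 𝕜 V] [PartialOrder V] [IsOrderedAddMonoid V] [PosSMulMono 𝕜 V]
    {x : ι → V} (hx : 0 ≤ x) {l : ι →₀ 𝕜} (hl : 0 ≤ l) : 0 ≤ Finsupp.linearCombination 𝕜 x l :=
  Finset.sum_nonneg fun i _ => smul_nonneg (hl i) (hx i)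

theorem linearCombination_mapRange_natCast {ι M V : Type*} [AddCommMonoid M] [AddCommGroup V]
    [Module ℚ V] (ρ : M →+ V) (x : ι → M) (c : ι →₀ ℕ) :
    Finsupp.linearCombination ℚ (fun i => ρ (x i)) (c.mapRange Nat.cast Nat.cast_zero) =
      ρ (Finsupp.linearCombination ℕ x c) := by
  rw [Finsupp.linearCombination_apply, Finsupp.linearCombination_apply, map_finsuppSum,
    Finsupp.sum_mapRange_index fun i => zero_smul ℚ (ρ (x i))]
  simp only [Nat.cast_smul_eq_nsmul, map_nsmul]

theorem degree_mapRange_natCast {ι : Type*} (c : ι →₀ ℕ) :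
    (c.mapRange (Nat.cast : ℕ → ℚ) Nat.cast_zero).degree = c.degree := by
  have := linearCombination_mapRange_natCast (Nat.castAddMonoidHom ℚ) (fun _ => 1) c
  simpa [Finsupp.linearCombination_apply, Finsupp.degree_apply, Finsupp.sum] using this

open Pointwise in
/-- A graded family of subsets of a commutative monoid generated in degree one, such as the sets of
exponents of the powers of a monomial ideal. -/
structure ExponentFiltration (M : Type*) [AddCommMonoid M] where
  /-- The step of index `e`. -/
  carrier : ℕ → Set M
  carrier_zero : carrier 0 = Set.univ
  carrier_add : ∀ a b, carrier (a + b) = carrier a + carrier b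

namespace ExponentFiltration

open Pointwise

section Basic

variable {M : Type*} [AddCommMonoid M] (T : ExponentFiltration M)

/-- The elements a positive multiple of which lies in the corresponding step of the filtration. For
the exponents of the powers of a monomial ideal `J`, these are the lattice points of `e` times the
Newton polyhedron of `J`. -/
def saturation (e : ℕ) : Set M :=
  {w | ∃ r, 0 < r ∧ r • w ∈ T.carrier (e * r)}

/-- The step of index `e` is saturated. -/
def IsClosedAt (e : ℕ) : Prop :=
  T.saturation e ⊆ T.carrier e

variable {T}

theorem isClosedAt_zero : T.IsClosedAt 0 := by
  rw [IsClosedAt, carrier_zero]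
  exact Set.subset_univ _

theorem add_mem {a b : ℕ} {z w : M} (hz : z ∈ T.carrier a) (hw : w ∈ T.carrier b) :
    z + w ∈ T.carrier (a + b) := by
  rw [carrier_add]
  exact Set.add_mem_add hz hw

theorem nsmul_mem {z : M} (hz : z ∈ T.carrier 1) (t : ℕ) : t • z ∈ T.carrier t := by
  induction t with
  | zero => rw [carrier_zero]; trivial
  | succ t ih => rw [succ_nsmul]; exact add_mem ih hz

theorem linearCombination_mem {G : Set M} (hG : G ⊆ T.carrier 1) (c : G →₀ ℕ) :
    Finsupp.linearCombination ℕ ((↑) : G → M) c ∈ T.carrier c.degree := by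
  induction c using Finsupp.induction with
  | zero => rw [map_zero, map_zero, carrier_zero]; trivial
  | single_add g a c _ _ ih =>
    rw [map_add, map_add, Finsupp.linearCombination_single, Finsupp.degree_single]
    exact add_mem (nsmul_mem (hG g.2) a) ih

variable (T) in
/-- The minimal elements of the step of index one; like minimal monomial generators, they describe
all the steps, see `mem_carrier_iff`. -/
def generators [LE M] : Set M :=
  {z | Minimal (· ∈ T.carrier 1) z}

theorem finite_generators [PartialOrder M] [WellQuasiOrderedLE M] : T.generators.Finite :=
  WellQuasiOrderedLE.finite_of_isAntichain (setOfPred_minimal_antichain _)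

theorem isUpperSet_carrier [PartialOrder M] [CanonicallyOrderedAdd M] (e : ℕ) :
    IsUpperSet (T.carrier e) := by
  intro z w hzw hz
  obtain ⟨d, rfl⟩ := exists_add_of_le hzw
  rw [← add_zero e]
  exact add_mem hz (by rw [carrier_zero]; trivial)

end Basic

section WellQuasiOrdered

variable {M : Type*} [AddCommMonoid M] [PartialOrder M] [CanonicallyOrderedAdd M]
  [IsOrderedAddMonoid M] [WellQuasiOrderedLE M] {T : ExponentFiltration M}

theorem mem_carrier_iff {t : ℕ} {z : M} : z ∈ T.carrier t ↔ ∃ c : T.generators →₀ ℕ,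
    c.degree = t ∧ Finsupp.linearCombination ℕ ((↑) : T.generators → M) c ≤ z := by
  refine ⟨fun hz => ?_, ?_⟩
  · induction t generalizing z with
    | zero => exact ⟨0, by simp⟩
    | succ t ih =>
      rw [carrier_add] at hz
      obtain ⟨x, hx, y, hy, rfl⟩ := hz
      obtain ⟨c, hct, hcx⟩ := ih hx
      obtain ⟨g, hgy, hg⟩ := exists_minimal_le_of_wellFoundedLT (· ∈ T.carrier 1) y hy
      refine ⟨c + Finsupp.single ⟨g, hg⟩ 1, by simp [hct], ?_⟩
      rw [map_add, Finsupp.linearCombination_single, one_smul]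
      exact add_le_add hcx hgy
  · rintro ⟨c, rfl, hcz⟩
    exact isUpperSet_carrier _ hcz (linearCombination_mem (fun z hz => hz.prop) c)

/- The exponents `e * s` and the summands `c s`, `d s` in `v + s • w = ∑ c s g • g + d s` are
simultaneously monotone along some pair `s < s + r`, and subtracting the two equations leaves
`r • w`. -/
theorem mem_saturation_of_forall_add_nsmul_mem [IsCancelAdd M] {v w : M} {e : ℕ}
    (h : ∀ s : ℕ, v + s • w ∈ T.carrier (e * s)) : w ∈ T.saturation e := by
  have := (finite_generators (T := T)).to_subtype
  choose c hc hcs using fun s => mem_carrier_iff.1 (h s)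
  choose d hd using fun s => exists_add_of_le (hcs s)
  obtain ⟨s, t, hst, hcst, hdst⟩ := wellQuasiOrdered_le fun s => (c s, d s)
  obtain ⟨r, rfl⟩ := exists_add_of_le hst.le
  obtain ⟨k, hk⟩ := exists_add_of_le hcst
  obtain ⟨b, hb⟩ := exists_add_of_le hdst
  dsimp only at hk hb
  have hdeg : k.degree = e * r := by
    have := hc (s + r)
    rw [hk, map_add, hc s, mul_add] at this
    exact Nat.add_left_cancel this
  refine ⟨r, by lia, mem_carrier_iff.2 ⟨k, hdeg, ?_⟩⟩
  suffices r • w = Finsupp.linearCombination ℕ ((↑) : T.generators → M) k + b by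
    rw [this]; exact le_self_add
  refine add_left_cancel (a := v + s • w) ?_
  rw [add_assoc, ← add_smul, hd (s + r), hk, hb, map_add, hd s]
  abel

theorem mem_saturation_iff {V : Type*} [AddCommGroup V] [PartialOrder V] [Module ℚ V]
    [PosSMulMono ℚ V] [PosSMulReflectLE ℚ V] {ρ : M →+ V} (hρ : ∀ {z w}, ρ z ≤ ρ w ↔ z ≤ w)
    {w : M} {e : ℕ} :
    w ∈ T.saturation e ↔ ∃ l : T.generators →₀ ℚ, 0 ≤ l ∧ l.degree = e ∧
      Finsupp.linearCombination ℚ (fun g : T.generators => ρ g) l ≤ ρ w := by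
  constructor
  · rintro ⟨r, hr, hw⟩
    obtain ⟨c, hc, hcw⟩ := mem_carrier_iff.1 hw
    have hr' : (0 : ℚ) < r := Nat.cast_pos.2 hr
    refine ⟨(r : ℚ)⁻¹ • c.mapRange Nat.cast Nat.cast_zero,
      smul_nonneg (inv_nonneg.2 hr'.le) fun g => Nat.cast_nonneg (c g), ?_, ?_⟩
    · rw [map_inv_natCast_smul _ ℚ ℚ, degree_mapRange_natCast, hc, Nat.cast_mul,
        mul_comm, smul_eq_mul, inv_mul_cancel_left₀ hr'.ne']
    · rw [map_smul, inv_smul_le_iff_of_pos hr', Nat.cast_smul_eq_nsmul, ← map_nsmul]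
      exact (linearCombination_mapRange_natCast ρ _ c).trans_le (hρ.2 hcw)
  · rintro ⟨l, hl, hdeg, hlw⟩
    obtain ⟨q, hq, c, hc⟩ := exists_nsmul_eq_mapRange_natCast hl
    refine ⟨q, hq, mem_carrier_iff.2 ⟨c, ?_, hρ.1 ?_⟩⟩
    · have := degree_mapRange_natCast c
      rw [← hc, map_nsmul, hdeg, nsmul_eq_mul] at this
      exact_mod_cast this.symm.trans (mul_comm _ _)
    · rw [← linearCombination_mapRange_natCast, ← hc, map_nsmul, map_nsmul,
        ← Nat.cast_smul_eq_nsmul ℚ, ← Nat.cast_smul_eq_nsmul ℚ]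
      exact smul_le_smul_of_nonneg_left hlw (Nat.cast_nonneg q)

end WellQuasiOrdered

section Lattice

variable {σ : Type*}

/-- The inclusion of the exponent vectors `(i, m)` into the rational vector space containing the
Newton polyhedra. -/
def rationalPoint : ℕ × (σ →₀ ℕ) →+ ℚ × (σ → ℚ) where
  toFun z := (z.1, fun j => z.2 j)
  map_zero' := by ext <;> simp
  map_add' z w := by ext <;> simp

theorem rationalPoint_le_iff {z w : ℕ × (σ →₀ ℕ)} :
    rationalPoint z ≤ rationalPoint w ↔ z ≤ w := by
  simp [rationalPoint, Prod.le_def, Pi.le_def, Finsupp.le_def]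

theorem rationalPoint_nonneg (z : ℕ × (σ →₀ ℕ)) : 0 ≤ rationalPoint z := by
  rw [← map_zero rationalPoint, rationalPoint_le_iff]
  exact zero_le

variable [Fintype σ] {T : ExponentFiltration (ℕ × (σ →₀ ℕ))}

theorem saturation_succ_subset {e : ℕ} (he : Fintype.card σ ≤ e) :
    T.saturation (e + 1) ⊆ T.saturation e + T.carrier 1 := by
  classical
  intro w hw
  obtain ⟨l₀, hl₀, hdeg₀, hlw₀⟩ := (mem_saturation_iff rationalPoint_le_iff).1 hw
  obtain ⟨l, hl, hcard, hdeg, hle⟩ :=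
    exists_card_support_le_finrank_succ
      (fun g : T.generators => (rationalPoint_nonneg (g : ℕ × (σ →₀ ℕ))).1) hl₀
  rw [Module.finrank_fintype_fun_eq_card] at hcard
  obtain ⟨g, -, hg⟩ : ∃ g ∈ l.support, 1 ≤ l g := by
    refine Finset.exists_le_of_sum_le (f := fun _ => (1 : ℚ)) ?_ ?_
    · rw [Finsupp.support_nonempty_iff]
      rintro rfl
      rw [map_zero, hdeg₀] at hdeg
      exact Nat.cast_ne_zero.2 e.succ_ne_zero hdeg.symm
    · rw [← Finsupp.degree_apply, hdeg, hdeg₀, Finset.sum_const, nsmul_one, Nat.cast_le]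
      lia
  have hl' : 0 ≤ l - Finsupp.single g 1 := by
    intro j
    rcases eq_or_ne j g with rfl | hj
    · simpa using hg
    · simpa [hj] using hl j
  have hsplit : Finsupp.linearCombination ℚ (fun g : T.generators => rationalPoint ↑g)
      (l - Finsupp.single g 1) ≤ rationalPoint w - rationalPoint ↑g := by
    rw [map_sub, Finsupp.linearCombination_single, one_smul]
    exact sub_le_sub_right (hle.trans hlw₀) _
  have hgw : (g : ℕ × (σ →₀ ℕ)) ≤ w := rationalPoint_le_iff.1 <| sub_nonneg.1 <|
    (linearCombination_nonneg (fun g => rationalPoint_nonneg _) hl').trans hsplit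
  obtain ⟨w', rfl⟩ := exists_add_of_le hgw
  rw [map_add, add_sub_cancel_left] at hsplit
  rw [add_comm g.1]
  refine Set.add_mem_add ((mem_saturation_iff rationalPoint_le_iff).2 ⟨_, hl', ?_, hsplit⟩) g.2.prop
  rw [map_sub, Finsupp.degree_single, hdeg, hdeg₀]
  push_cast
  ring

theorem isClosedAt_succ {e : ℕ} (he : Fintype.card σ ≤ e) (hT : T.IsClosedAt e) :
    T.IsClosedAt (e + 1) := by
  rw [IsClosedAt, carrier_add]
  exact (saturation_succ_subset he).trans (Set.add_subset_add_right hT)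

theorem isClosedAt_of_forall_le_card (hT : ∀ e, 1 ≤ e → e ≤ Fintype.card σ → T.IsClosedAt e)
    (e : ℕ) : T.IsClosedAt e := by
  induction e with
  | zero => exact isClosedAt_zero
  | succ e ih =>
    rcases le_or_gt (e + 1) (Fintype.card σ) with h | h
    · exact hT _ e.succ_pos h
    · exact isClosedAt_succ (Nat.lt_succ_iff.1 h) ih

end Lattice

end ExponentFiltration

section IntegralOverIdeal

variable {A B : Type*} [CommRing A] [CommRing B]

theorem isIntegralOverIdeal_of_pow_mem {I : Ideal A} {a : A} {r : ℕ} (hr : 0 < r)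
    (h : a ^ r ∈ I ^ r) : IsIntegralOverIdeal I a := by
  refine ⟨r, hr, Pi.single r (-a ^ r), fun i _ => ?_, ?_⟩
  · rcases eq_or_ne i r with rfl | hi
    · rw [Pi.single_eq_same]
      exact neg_mem h
    · rw [Pi.single_eq_of_ne hi]
      exact zero_mem _
  · rw [Finset.sum_eq_single_of_mem r (Finset.right_mem_Icc.2 hr)
      fun i _ hi => by rw [Pi.single_eq_of_ne hi, zero_mul]]
    simp

theorem mul_pow_mem_of_forall_lt {I : Ideal A} {a b : A} {r : ℕ} {c : ℕ → A}
    (hc : ∀ i ∈ Finset.Icc 1 r, c i ∈ I ^ i)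
    (heq : a ^ r + ∑ i ∈ Finset.Icc 1 r, c i * a ^ (r - i) = 0)
    (hb : ∀ s < r, b * a ^ s ∈ I ^ s) (s : ℕ) : b * a ^ s ∈ I ^ s := by
  induction s using Nat.strong_induction_on with | _ s ih
  rcases lt_or_ge s r with hs | hs
  · exact hb s hs
  obtain ⟨t, rfl⟩ := exists_add_of_le hs
  have hexpand : b * a ^ (r + t) = -∑ i ∈ Finset.Icc 1 r, c i * (b * a ^ (r + t - i)) := by
    rw [pow_add, eq_neg_of_add_eq_zero_left heq, neg_mul, mul_neg, Finset.sum_mul, Finset.mul_sum]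
    refine congrArg _ (Finset.sum_congr rfl fun i hi => ?_)
    rw [Nat.sub_add_comm (Finset.mem_Icc.1 hi).2, pow_add]
    ring
  rw [hexpand]
  refine neg_mem (Ideal.sum_mem _ fun i hi => ?_)
  obtain ⟨hi, hir⟩ := Finset.mem_Icc.1 hi
  have := Ideal.mul_mem_mul (hc i (Finset.mem_Icc.2 ⟨hi, hir⟩)) (ih (r + t - i) (by lia))
  rwa [← pow_add, Nat.add_sub_cancel' (by lia)] at this

theorem IsIntegralOverIdeal.exists_mul_pow_mem [IsDomain A] {I : Ideal A} {a : A}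
    (ha : IsIntegralOverIdeal I a) (ha0 : a ≠ 0) : ∃ b ≠ 0, ∀ s, b * a ^ s ∈ I ^ s := by
  obtain ⟨r, -, c, hc, heq⟩ := ha
  have hI : I ≠ ⊥ := by
    rintro rfl
    have hzero : ∀ i ∈ Finset.Icc 1 r, c i * a ^ (r - i) = 0 := fun i hi => by
      have hci := hc i hi
      rw [Ideal.bot_pow (Nat.one_le_iff_ne_zero.1 (Finset.mem_Icc.1 hi).1), Ideal.mem_bot] at hci
      rw [hci, zero_mul]
    rw [Finset.sum_eq_zero hzero, add_zero] at heq
    exact ha0 (eq_zero_of_pow_eq_zero heq)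
  obtain ⟨x, hx, hx0⟩ := Submodule.exists_mem_ne_zero_of_ne_bot hI
  refine ⟨x ^ (r - 1), pow_ne_zero _ hx0, mul_pow_mem_of_forall_lt hc heq fun s hs => ?_⟩
  exact Ideal.mul_mem_right _ _ (Ideal.pow_le_pow_right (by lia) (Ideal.pow_mem_pow hx _))

theorem mul_sub_pow_mem {I : Ideal A} {a b c : A} (ha : ∀ s, c * a ^ s ∈ I ^ s) (hb : b ∈ I)
    (s : ℕ) : c * (a - b) ^ s ∈ I ^ s := by
  rw [sub_eq_add_neg, add_pow, Finset.mul_sum]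
  refine Ideal.sum_mem _ fun i hi => ?_
  have := Ideal.mul_mem_mul (ha i) (Ideal.pow_mem_pow (neg_mem hb) (s - i))
  rw [← pow_add, Nat.add_sub_cancel' (Nat.lt_succ_iff.1 (Finset.mem_range.1 hi))] at this
  simpa only [mul_assoc] using Ideal.mul_mem_right _ _ this

theorem IsIntegralOverIdeal.map (φ : A →+* B) {I : Ideal A} {a : A}
    (h : IsIntegralOverIdeal I a) : IsIntegralOverIdeal (I.map φ) (φ a) := by
  obtain ⟨r, hr, c, hc, heq⟩ := h
  refine ⟨r, hr, φ ∘ c, fun i hi => ?_, ?_⟩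
  · rw [← Ideal.map_pow]
    exact Ideal.mem_map_of_mem φ (hc i hi)
  · simpa using congrArg φ heq

theorem IsIntegrallyClosedIdeal.map_ringEquiv (φ : A ≃+* B) {I : Ideal A}
    (h : IsIntegrallyClosedIdeal I) : IsIntegrallyClosedIdeal (I.map (φ : A →+* B)) := by
  intro b hb
  have hsymm := hb.map (φ.symm : B →+* A)
  rw [Ideal.map_of_equiv] at hsymm
  exact (Ideal.mem_map_of_equiv φ b).2 ⟨_, h _ hsymm, φ.apply_symm_apply b⟩

theorem isIntegrallyClosedIdeal_map_ringEquiv_iff (φ : A ≃+* B) {I : Ideal A} :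
    IsIntegrallyClosedIdeal (I.map (φ : A →+* B)) ↔ IsIntegrallyClosedIdeal I := by
  refine ⟨fun h => ?_, fun h => h.map_ringEquiv φ⟩
  have hsymm := h.map_ringEquiv φ.symm
  rwa [Ideal.map_of_equiv] at hsymm

theorem isIntegrallyClosedIdeal_pow_map_ringEquiv_iff (φ : A ≃+* B) {I : Ideal A} {e : ℕ} :
    IsIntegrallyClosedIdeal (I.map (φ : A →+* B) ^ e) ↔ IsIntegrallyClosedIdeal (I ^ e) := by
  rw [← Ideal.map_pow, isIntegrallyClosedIdeal_map_ringEquiv_iff]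

end IntegralOverIdeal

section DedekindDomain

variable {R : Type*} [CommRing R] [IsDedekindDomain R] {P : Ideal R}

theorem exists_le_pow_and_not_le_pow_succ (hP : P ≠ ⊤) {I : Ideal R} (hI : I ≠ ⊥) :
    ∃ i, I ≤ P ^ i ∧ ¬ I ≤ P ^ (i + 1) := by
  by_contra! h
  refine hI (eq_bot_iff.2 ?_)
  rw [← Ideal.iInf_pow_eq_bot_of_isDomain P hP]
  exact le_iInf fun i => Nat.rec (by simp) h i

theorem not_mul_le_pow_add_succ [P.IsPrime] {I J : Ideal R} {i j : ℕ} (hI : ¬ I ≤ P ^ (i + 1))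
    (hJ : ¬ J ≤ P ^ (j + 1)) : ¬ I * J ≤ P ^ (i + j + 1) := by
  rcases eq_or_ne P ⊥ with rfl | hP
  · simp only [Ideal.bot_pow (Nat.succ_ne_zero _), le_bot_iff] at hI hJ ⊢
    exact mul_ne_zero hI hJ
  · rw [← Ideal.dvd_iff_le, ← emultiplicity_lt_iff_not_dvd] at hI hJ ⊢
    rw [emultiplicity_mul (Ideal.prime_of_isPrime hP ‹_›)]
    rw [Nat.cast_succ, ENat.lt_natCast_add_one_iff] at hI hJ ⊢
    rw [Nat.cast_add]
    exact add_le_add hI hJ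

theorem mul_notMem_pow_add_succ [P.IsPrime] {a b : R} {i j : ℕ} (ha : a ∉ P ^ (i + 1))
    (hb : b ∉ P ^ (j + 1)) : a * b ∉ P ^ (i + j + 1) := by
  rw [← Ideal.span_singleton_le_iff_mem] at ha hb ⊢
  rw [← Ideal.span_singleton_mul_span_singleton]
  exact not_mul_le_pow_add_succ ha hb

theorem pow_notMem_pow_mul_succ [P.IsPrime] {a : R} {i : ℕ} (ha : a ∉ P ^ (i + 1)) (s : ℕ) :
    a ^ s ∉ P ^ (s * i + 1) := by
  induction s with
  | zero => simpa using P.one_notMem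
  | succ s ih => rw [pow_succ a, Nat.succ_mul]; exact mul_notMem_pow_add_succ ih ha

theorem exists_notMem_dvd_mul (hP : P ≠ ⊤) {a b : R} {i : ℕ} (ha : a ∉ P ^ (i + 1))
    (hb : b ∈ P ^ i) : ∃ s ∉ P, a ∣ s * b := by
  have ha0 : a ≠ 0 := by
    rintro rfl
    exact ha (zero_mem _)
  obtain ⟨j, Q, hQ, haQ⟩ : ∃ j Q, ¬ P ∣ Q ∧ Ideal.span {a} = P ^ j * Q :=
    WfDvdMonoid.max_power_factor' (mt Ideal.span_singleton_eq_bot.1 ha0) (mt Ideal.isUnit_iff.1 hP)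
  have hji : j ≤ i := by
    by_contra! hij
    suffices haj : a ∈ P ^ j from ha (Ideal.pow_le_pow_right hij haj)
    rw [← Ideal.span_singleton_le_iff_mem, haQ]
    exact Ideal.mul_le_left
  obtain ⟨s, hsQ, hsP⟩ := SetLike.not_le_iff_exists.1 (mt Ideal.dvd_iff_le.2 hQ)
  refine ⟨s, hsP, ?_⟩
  rw [← Ideal.mem_span_singleton, haQ, mul_comm s]
  exact Ideal.mul_mem_mul (Ideal.pow_le_pow_right hji hb) hsQ

theorem exists_notMem_pow_succ_dvd_pow [P.IsPrime] {a : R} {r i : ℕ} (hr : 0 < r)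
    (ha : a ∉ P ^ (r * i + 1)) : ∃ b ∉ P ^ (i + 1), a ∣ b ^ r := by
  rcases eq_or_ne P ⊥ with rfl | hP
  · rw [Ideal.bot_pow (Nat.succ_ne_zero _)] at ha ⊢
    exact ⟨a, ha, dvd_pow_self a hr.ne'⟩
  · have hPtop : P ≠ ⊤ := Ideal.IsPrime.ne_top ‹_›
    obtain ⟨c, hc, hc'⟩ := P.exists_mem_pow_notMem_pow_succ hP hPtop i
    have hcr : c ^ r ∈ P ^ (r * i) := by
      rw [mul_comm, pow_mul]
      exact Ideal.pow_mem_pow hc r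
    obtain ⟨s, hs, hdvd⟩ := exists_notMem_dvd_mul hPtop ha hcr
    refine ⟨s * c, ?_, ?_⟩
    · simpa using mul_notMem_pow_add_succ (i := 0) (by simpa using hs) hc'
    · rw [mul_pow]
      exact hdvd.trans (mul_dvd_mul_right (dvd_pow_self s hr.ne') _)

theorem mem_of_forall_le_pow_imp_mem {I : Ideal R} {a : R}
    (h : ∀ P : Ideal R, P.IsMaximal → ∀ i, I ≤ P ^ i → a ∈ P ^ i) : a ∈ I := by
  rcases eq_or_ne a 0 with rfl | ha
  · exact zero_mem _
  by_contra haI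
  have hcolon : I.colon {a} ≠ ⊤ := by
    rwa [Ne, Ideal.eq_top_iff_one, Submodule.mem_colon_singleton, one_smul]
  obtain ⟨P, hP, hle⟩ := Ideal.exists_le_maximal _ hcolon
  obtain ⟨i, hai, hai'⟩ := exists_le_pow_and_not_le_pow_succ hP.ne_top
    (mt Ideal.span_singleton_eq_bot.1 ha)
  rw [Ideal.span_singleton_le_iff_mem] at hai hai'
  obtain ⟨b, hbI, hb⟩ := SetLike.not_le_iff_exists.1 (mt (h P hP (i + 1)) hai')
  obtain ⟨s, hs, hbs⟩ := exists_notMem_dvd_mul hP.ne_top hb hai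
  exact hs (hle (Submodule.mem_colon_singleton.2 (I.mem_of_dvd hbs hbI)))

end DedekindDomain

section Multigraded

open MvPolynomial Pointwise
open Finset.HasAntidiagonal (antidiagonal mem_antidiagonal)

variable {σ R : Type*} [CommRing R]

/-- The ideal `{a | a xᵐ ∈ J}` of the coefficient ring. -/
noncomputable def coeffIdeal (J : Ideal (MvPolynomial σ R)) (m : σ →₀ ℕ) : Ideal R :=
  (J.restrictScalars R).comap (monomial m)

theorem mem_coeffIdeal {J : Ideal (MvPolynomial σ R)} {m : σ →₀ ℕ} {a : R} :
    a ∈ coeffIdeal J m ↔ monomial m a ∈ J :=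
  Iff.rfl

theorem coeffIdeal_mul_le (J K : Ideal (MvPolynomial σ R)) (m n : σ →₀ ℕ) :
    coeffIdeal J m * coeffIdeal K n ≤ coeffIdeal (J * K) (m + n) := by
  refine Ideal.mul_le.2 fun a ha b hb => ?_
  rw [mem_coeffIdeal, ← monomial_mul]
  exact Ideal.mul_mem_mul ha hb

/-- The ideal `J` is homogeneous for the grading of the polynomial ring by exponent vectors: it
contains the terms of all its elements. -/
def IsMultigraded (J : Ideal (MvPolynomial σ R)) : Prop :=
  ∀ f ∈ J, ∀ m, coeff m f ∈ coeffIdeal J m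

theorem isMultigraded_top : IsMultigraded (⊤ : Ideal (MvPolynomial σ R)) :=
  fun _ _ _ => Submodule.mem_top

theorem IsMultigraded.coeff_mem_sup_of_mem_mul [DecidableEq σ] {J K : Ideal (MvPolynomial σ R)}
    (hJ : IsMultigraded J) (hK : IsMultigraded K) {f : MvPolynomial σ R} (hf : f ∈ J * K)
    (m : σ →₀ ℕ) : coeff m f ∈
      (antidiagonal m).sup fun x => coeffIdeal J x.1 * coeffIdeal K x.2 := by
  induction hf using Submodule.mul_induction_on' with
  | mem_mul_mem f hf g hg =>
    rw [coeff_mul]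
    exact Ideal.sum_mem _ fun x hx => Finset.le_sup (f := fun x => coeffIdeal J x.1 *
      coeffIdeal K x.2) hx (Ideal.mul_mem_mul (hJ f hf x.1) (hK g hg x.2))
  | add f _ g _ ihf ihg => rw [coeff_add]; exact add_mem ihf ihg

theorem sup_coeffIdeal_mul_le [DecidableEq σ] (J K : Ideal (MvPolynomial σ R)) (m : σ →₀ ℕ) :
    ((antidiagonal m).sup fun x => coeffIdeal J x.1 * coeffIdeal K x.2) ≤
      coeffIdeal (J * K) m :=
  Finset.sup_le fun x hx => mem_antidiagonal.1 hx ▸ coeffIdeal_mul_le J K x.1 x.2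

theorem IsMultigraded.coeffIdeal_mul [DecidableEq σ] {J K : Ideal (MvPolynomial σ R)}
    (hJ : IsMultigraded J) (hK : IsMultigraded K) (m : σ →₀ ℕ) : coeffIdeal (J * K) m =
      (antidiagonal m).sup fun x => coeffIdeal J x.1 * coeffIdeal K x.2 := by
  refine le_antisymm (fun a ha => ?_) (sup_coeffIdeal_mul_le J K m)
  simpa using hJ.coeff_mem_sup_of_mem_mul hK ha m

theorem IsMultigraded.mul {J K : Ideal (MvPolynomial σ R)} (hJ : IsMultigraded J)
    (hK : IsMultigraded K) : IsMultigraded (J * K) := by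
  classical
  exact fun f hf m => sup_coeffIdeal_mul_le J K m (hJ.coeff_mem_sup_of_mem_mul hK hf m)

theorem IsMultigraded.pow {J : Ideal (MvPolynomial σ R)} (hJ : IsMultigraded J) (e : ℕ) :
    IsMultigraded (J ^ e) := by
  induction e with
  | zero => rw [pow_zero, Ideal.one_eq_top]; exact isMultigraded_top
  | succ e ih => rw [pow_succ]; exact ih.mul hJ

/-- The exponents `(i, m)` such that `P ^ i * xᵐ` lies in the localization of `J` at `P`, for a
nonzero prime ideal `P` of a Dedekind domain: some element of `coeffIdeal J m` has `P`-adic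
valuation at most `i`. -/
def localExponents (P : Ideal R) (J : Ideal (MvPolynomial σ R)) : Set (ℕ × (σ →₀ ℕ)) :=
  {z | ¬ coeffIdeal J z.2 ≤ P ^ (z.1 + 1)}

theorem mem_localExponents {P : Ideal R} {J : Ideal (MvPolynomial σ R)} {i : ℕ} {m : σ →₀ ℕ} :
    (i, m) ∈ localExponents P J ↔ ∃ a, monomial m a ∈ J ∧ a ∉ P ^ (i + 1) :=
  SetLike.not_le_iff_exists

theorem localExponents_top {P : Ideal R} [P.IsPrime] :
    localExponents P (⊤ : Ideal (MvPolynomial σ R)) = Set.univ := by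
  refine Set.eq_univ_of_forall fun z => mem_localExponents.2 ⟨1, Submodule.mem_top, fun h => ?_⟩
  exact P.one_notMem (Ideal.pow_le_self z.1.succ_ne_zero h)

theorem IsMultigraded.localExponents_mul [IsDedekindDomain R] {P : Ideal R} [P.IsPrime]
    {J K : Ideal (MvPolynomial σ R)} (hJ : IsMultigraded J) (hK : IsMultigraded K) :
    localExponents P (J * K) = localExponents P J + localExponents P K := by
  classical
  refine Set.Subset.antisymm (fun ⟨i, m⟩ hz => ?_) ?_
  · obtain ⟨⟨m₁, m₂⟩, hm, hnle⟩ : ∃ x ∈ antidiagonal m,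
        ¬ coeffIdeal J x.1 * coeffIdeal K x.2 ≤ P ^ (i + 1) := by
      by_contra! hle
      exact hz ((hJ.coeffIdeal_mul hK m).trans_le (Finset.sup_le hle))
    have hbot : coeffIdeal J m₁ ≠ ⊥ := by
      intro h
      simp [h] at hnle
    obtain ⟨j, hj, hj'⟩ := exists_le_pow_and_not_le_pow_succ (Ideal.IsPrime.ne_top ‹P.IsPrime›) hbot
    have hji : j ≤ i := by
      by_contra! hij
      exact hnle ((Ideal.mul_le_left.trans hj).trans (Ideal.pow_le_pow_right hij))
    refine ⟨(j, m₁), hj', (i - j, m₂), fun hle => hnle ?_, ?_⟩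
    · have hmul := Ideal.mul_mono hj hle
      rwa [← pow_add, ← add_assoc, Nat.add_sub_cancel' hji] at hmul
    · exact Prod.ext (Nat.add_sub_cancel' hji) (mem_antidiagonal.1 hm)
  · rintro _ ⟨z, hz, w, hw, rfl⟩ hle
    exact not_mul_le_pow_add_succ hz hw ((coeffIdeal_mul_le J K z.2 w.2).trans hle)

/-- The local exponents at `P` of the powers of `J`. -/
def localExponentFiltration [IsDedekindDomain R] (P : Ideal R) [P.IsPrime]
    {J : Ideal (MvPolynomial σ R)} (hJ : IsMultigraded J) :
    ExponentFiltration (ℕ × (σ →₀ ℕ)) where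
  carrier e := localExponents P (J ^ e)
  carrier_zero := by rw [pow_zero, Ideal.one_eq_top, localExponents_top]
  carrier_add a b := by rw [pow_add, (hJ.pow a).localExponents_mul (hJ.pow b)]

theorem isClosedAt_localExponentFiltration [IsDedekindDomain R] (P : Ideal R) [P.IsPrime]
    {J : Ideal (MvPolynomial σ R)} (hJ : IsMultigraded J) {e : ℕ}
    (he : IsIntegrallyClosedIdeal (J ^ e)) : (localExponentFiltration P hJ).IsClosedAt e := by
  rintro ⟨i, m⟩ ⟨r, hr, hmem⟩
  obtain ⟨a, ha, haP⟩ := mem_localExponents.1 hmem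
  obtain ⟨b, hbP, hab⟩ := exists_notMem_pow_succ_dvd_pow hr haP
  refine mem_localExponents.2 ⟨b, he _ (isIntegralOverIdeal_of_pow_mem hr ?_), hbP⟩
  rw [monomial_pow, ← pow_mul]
  exact (coeffIdeal _ _).mem_of_dvd hab ha

theorem monomial_mem_of_forall_mem_localExponents [IsDedekindDomain R]
    {J : Ideal (MvPolynomial σ R)} {m : σ →₀ ℕ} {a : R}
    (h : ∀ P : Ideal R, P.IsMaximal → ∀ i, a ∉ P ^ (i + 1) → (i, m) ∈ localExponents P J) :
    monomial m a ∈ J := by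
  refine mem_coeffIdeal.1 (mem_of_forall_le_pow_imp_mem fun P hP i hle => ?_)
  cases i with
  | zero => simp
  | succ i => exact by_contra fun ha => h P hP i ha hle

theorem leadingTerm_mem_pow [IsDedekindDomain R] [Finite σ] (o : MonomialOrder σ)
    {J : Ideal (MvPolynomial σ R)} (hJ : IsMultigraded J) {e : ℕ}
    (hclosed : ∀ (P : Ideal R) [P.IsPrime], (localExponentFiltration P hJ).IsClosedAt e)
    {c f : MvPolynomial σ R} (hc : c ≠ 0) (hcf : ∀ s, c * f ^ s ∈ (J ^ e) ^ s) :
    o.leadingTerm f ∈ J ^ e := by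
  rcases eq_or_ne f 0 with rfl | hf
  · simp
  refine monomial_mem_of_forall_mem_localExponents fun P hP i hi => ?_
  have := hP.isPrime
  obtain ⟨j, -, hj⟩ := exists_le_pow_and_not_le_pow_succ hP.ne_top
    (mt Ideal.span_singleton_eq_bot.1 (o.leadingCoeff_ne_zero_iff.2 hc))
  rw [Ideal.span_singleton_le_iff_mem] at hj
  refine hclosed P (ExponentFiltration.mem_saturation_of_forall_add_nsmul_mem
    (v := (j, o.degree c)) fun s => mem_localExponents.2
      ⟨_, ?_, mul_notMem_pow_add_succ hj (pow_notMem_pow_mul_succ hi s)⟩)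
  have hlead := (hJ.pow (e * s)) _ (pow_mul J e s ▸ hcf s) (o.degree (c * f ^ s))
  rwa [← MonomialOrder.leadingCoeff, o.leadingCoeff_mul, o.leadingCoeff_pow,
    o.degree_mul hc (pow_ne_zero _ hf), o.degree_pow, mem_coeffIdeal] at hlead

theorem isIntegrallyClosedIdeal_pow_of_isClosedAt [IsDedekindDomain R] [Finite σ]
    {J : Ideal (MvPolynomial σ R)} (hJ : IsMultigraded J) {e : ℕ}
    (hclosed : ∀ (P : Ideal R) [P.IsPrime], (localExponentFiltration P hJ).IsClosedAt e) :
    IsIntegrallyClosedIdeal (J ^ e) := by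
  let : LinearOrder σ := LinearOrder.lift' _ (Finite.equivFin σ).injective
  let o : MonomialOrder σ := MonomialOrder.lex
  intro f hf
  rcases eq_or_ne f 0 with rfl | hf0
  · exact zero_mem _
  obtain ⟨c, hc, hcf⟩ := hf.exists_mul_pow_mem hf0
  clear hf hf0
  induction hd : o.toSyn (o.degree f) using WellFoundedLT.induction generalizing f with | ind d ih
  have hlead := leadingTerm_mem_pow o hJ hclosed hc hcf
  suffices hsub : f - o.leadingTerm f ∈ J ^ e by simpa using add_mem hsub hlead
  rcases eq_or_ne (f - o.leadingTerm f) 0 with hsub | hsub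
  · rw [hsub]
    exact zero_mem _
  · have hdeg := MonomialOrder.degree_ne_zero_of_sub_leadingTerm_ne_zero hsub
    exact ih _ (hd ▸ o.degree_sub_leadingTerm_lt_degree hdeg) _ (mul_sub_pow_mem hcf hlead) rfl

theorem isNormalIdeal_iff_forall_le_card [IsDedekindDomain R] [Fintype σ]
    {J : Ideal (MvPolynomial σ R)} (hJ : IsMultigraded J) :
    IsNormalIdeal J ↔ ∀ e ∈ Finset.Icc 1 (Fintype.card σ), IsIntegrallyClosedIdeal (J ^ e) := by
  refine ⟨fun h e he => h e (Finset.mem_Icc.1 he).1, fun h e _ => ?_⟩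
  refine isIntegrallyClosedIdeal_pow_of_isClosedAt hJ fun P _ =>
    ExponentFiltration.isClosedAt_of_forall_le_card (fun e' he' hcard => ?_) e
  exact isClosedAt_localExponentFiltration P hJ (h e' (Finset.mem_Icc.2 ⟨he', hcard⟩))

end Multigraded

section Transport

open MvPolynomial

/-- The isomorphism `k[x₀, …, x_n] ≃ k[x₀][x₁, …, x_n]`, which turns homogeneity for the
`ℤⁿ`-grading into `IsMultigraded` with coefficients in the Dedekind domain `k[x₀]`. -/
noncomputable def splitFirstVariable (k : Type*) [CommRing k] (n : ℕ) :
    MvPolynomial (Fin (n + 1)) k ≃+* MvPolynomial (Fin n) (Polynomial k) :=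
  ((renameEquiv k (_root_.finSuccEquiv n)).trans (optionEquivRight k (Fin n))).toRingEquiv

theorem splitFirstVariable_monomial {k : Type*} [CommRing k] {n : ℕ} (d : Fin (n + 1) →₀ ℕ)
    (b : k) : splitFirstVariable k n (monomial d b) =
      monomial (Finsupp.tail d) (Polynomial.monomial (d 0) b) := by
  rw [monomial_eq, monomial_eq, Finsupp.prod_fintype _ _ (by simp),
    Finsupp.prod_fintype _ _ (by simp), Fin.prod_univ_succ, ← Polynomial.C_mul_X_pow_eq_monomial]
  simp [splitFirstVariable, mul_assoc, Finsupp.tail_apply]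

theorem splitFirstVariable_weightedHomogeneousComponent {k : Type*} [CommRing k] {n : ℕ}
    (m : Fin n →₀ ℕ) (f : MvPolynomial (Fin (n + 1)) k) :
    splitFirstVariable k n (weightedHomogeneousComponent (varDegree n) (fun i => (m i : ℤ)) f) =
      monomial m (coeff m (splitFirstVariable k n f)) := by
  classical
  induction f using MvPolynomial.induction_on' with
  | monomial d b =>
    rw [splitFirstVariable_monomial, coeff_monomial,
      weightedHomogeneousComponent_of_mem (n := fun i => (d i.succ : ℤ))
        (isWeightedHomogeneous_monomial _ _ _ (weight_varDegree n d))]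
    have hiff : ((fun i => (m i : ℤ)) = fun i => (d i.succ : ℤ)) ↔ Finsupp.tail d = m := by
      simp [funext_iff, Finsupp.ext_iff, Finsupp.tail_apply, eq_comm]
    by_cases h : Finsupp.tail d = m
    · rw [if_pos (hiff.2 h), if_pos h, splitFirstVariable_monomial, h]
    · rw [if_neg (mt hiff.1 h), if_neg h, map_zero, map_zero]
  | add f g hf hg => rw [map_add, map_add, map_add, coeff_add, map_add, hf, hg]

theorem isMultigraded_map_splitFirstVariable {k : Type*} [Field k] {n : ℕ}
    {I : Ideal (MvPolynomial (Fin (n + 1)) k)} (hI : I.IsHomogeneous (gradedPiece k n)) :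
    IsMultigraded (I.map (splitFirstVariable k n :
      MvPolynomial (Fin (n + 1)) k →+* MvPolynomial (Fin n) (Polynomial k))) := by
  intro g hg m
  obtain ⟨f, hf, rfl⟩ := (Ideal.mem_map_of_equiv (splitFirstVariable k n) g).1 hg
  rw [mem_coeffIdeal, ← splitFirstVariable_weightedHomogeneousComponent]
  exact Ideal.mem_map_of_mem _ (weightedHomogeneousComponent_mem_of_mem k (varDegree n) hI hf _)

end Transport

theorem mainTheorem6_general {k : Type*} [Field k] (n : ℕ)
    (I : Ideal (MvPolynomial (Fin (n + 1)) k)) (hI : I.IsHomogeneous (gradedPiece k n)) :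
    IsNormalIdeal I ↔ ∀ e ∈ Finset.Icc 1 n, IsIntegrallyClosedIdeal (I ^ e) := by
  have h := isNormalIdeal_iff_forall_le_card (isMultigraded_map_splitFirstVariable hI)
  simpa only [IsNormalIdeal, isIntegrallyClosedIdeal_pow_map_ringEquiv_iff, Fintype.card_fin]
    using h

/-- Let `k` be an algebraically closed field of characteristic zero and `n ≥ 1`. An ideal `I` of
`k[x₀, …, x_n]` that is homogeneous for the `ℤⁿ`-grading with pieces `k[x₀] x₁ ^ m₁ ⋯ x_n ^ m_n` is
normal if and only if `I ^ e` is integrally closed for all `e ∈ {1, …, n}`. -/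
theorem mainTheorem6 {k : Type*} [Field k] [IsAlgClosed k] [CharZero k] (n : ℕ) (hn : 1 ≤ n)
    (I : Ideal (MvPolynomial (Fin (n + 1)) k)) (hI : I.IsHomogeneous (gradedPiece k n)) :
    IsNormalIdeal I ↔ ∀ e ∈ Finset.Icc 1 n, IsIntegrallyClosedIdeal (I ^ e) :=
  mainTheorem6_general n I hI
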